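/- Let $\mathcal M=(S,A,T,R,\gamma,\eta_0)$ be an MDP with deterministic transitions $T:S\times A\to S$, rewards $R(s,a)\in[0,1]$, discount factor $\gamma\in(0,1)$ and initial distribution $\eta_0$. For a policy $\pi:S\to A$ let $V^\pi(s)$ be its discounted total reward from $s$, $J(\pi)=\mathbb E_{s_0\sim\eta_0}[V^\pi(s_0)]$, and let $\pi^*$ be an optimal policy, i.e. one that maximizes $J$ over all policies. Let $\tilde S$ be a finite set of pairwise disjoint subgoal regions $\tilde s\subseteq S$ with union $\bar S$, let $E\subseteq\tilde S\times\tilde S$ be a set of edges, and let $\tilde s_0,\tilde s_g\in\tilde S$ be the initial and the goal region, where $\eta_0(S\setminus\tilde s_0)=0$. Subgoal transitions. A subgoal transition $o=(\pi,\tilde s)$ may be started at any $s\in\tilde s$; it follows the policy $\pi$ and terminates at the first time $t\ge1$ at which the state lies in $\bar S\setminus\tilde s$. Let $\tilde T(s,o,\tilde s')=\gamma^t$ if $o$ started at $s$ terminates after $t$ steps in $\tilde s'$, and $\tilde T(s,o,\tilde s')=0$ if it does not terminate in $\tilde s'$. Let $R_{\mathrm{opt}}(s,o)$ be the discounted reward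 collected by $o$ from $s$ before it terminates. For $o=(\pi,\tilde s)$ let $\tilde T_{\inf}(\tilde s,o,\tilde s')$, $\tilde T_{\sup}(\tilde s,o,\tilde s')$, $\tilde R_{\inf}(\tilde s,o)$ and $\tilde R_{\sup}(\tilde s,o)$ be the infima and suprema of $\tilde T(s,o,\tilde s')$ and of $R_{\mathrm{opt}}(s,o)$ over $s\in\tilde s$. The ideal subgoal transitions are $$\tilde{\mathcal O}=\{(\pi(\tilde s,\tilde s'),\tilde s)\mid(\tilde s,\tilde s')\in E,\ \tilde s\ne\tilde s',\ \tilde s\ne\tilde s_g\},\qquad \pi(\tilde s,\tilde s')\in\arg\max_\pi\tilde T_{\sup}(\tilde s,(\pi,\tilde s),\tilde s').$$ Let $\tilde{\mathcal O}(\tilde s)$ be the set of those that start in $\tilde s$, and let $$\varepsilon_T=\max_{\tilde s,\tilde s'\in\tilde S,\ o\in\tilde{\mathcal O}(\tilde s)}\bigl(\tilde T_{\sup}(\tilde s,o,\tilde s')-\tilde T_{\inf}(\tilde s,o,\tilde s')\bigr),\qquad \varepsilon_R=\max_{\tilde s\in\tilde S,\ o\in\tilde{\mathcal O}(\tilde s)}\bigl(\tilde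 R_{\sup}(\tilde s,o)-\tilde R_{\inf}(\tilde s,o)\bigr).$$ R-AVI. Robust abstract value iteration (R-AVI) solves the equations $$\tilde V(\tilde s)=\max_{o\in\tilde{\mathcal O}(\tilde s)}\tilde Q(\tilde s,o),\qquad \tilde Q(\tilde s,o)=\tilde R_{\inf}(\tilde s,o)+\sum_{\tilde s'\in\tilde S}\tilde T_{\inf}(\tilde s,o,\tilde s')\,\tilde V(\tilde s'),$$ and returns an option policy $\tilde\rho$ with $\tilde\rho(s)=\tilde\rho(\tilde s)\in\arg\max_{o\in\tilde{\mathcal O}(\tilde s)}\tilde Q(\tilde s,o)$ for $s\in\tilde s$. (A maximum over the empty set is $0$; where $\tilde{\mathcal O}(\tilde s)$ is empty, as for $\tilde s=\tilde s_g$, $\tilde\rho$ may use any policy.) It induces the policy $\pi_{\tilde\rho}$, which runs the option $\tilde\rho(\tilde s)$ on entering $\tilde s$ until it terminates in another region. Let $J(\pi_{\tilde\rho})$ be its expected discounted total reward from $\eta_0$. Assume: 1. (Sparse reachability.) $T(s,a)=s$ for all $s\in\tilde s_g$ and $a\in A$. Moreover $R(s,a)=1$ if $s\notin\tilde s_g$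 and $T(s,a)\in\tilde s_g$, and $R(s,a)=0$ otherwise. 2. $|\tilde S|\,\varepsilon_T<1-\gamma$. 3. (Bottleneck assumption.) For every trajectory $s_0,a_0,s_1,\dots,s_t$ of $\mathcal M$ with $s_0\in\tilde s_0$ and $s_t\in\tilde s_g$ there are indices $0=i_0<\dots<i_k=t$ and regions $\tilde r_0,\dots,\tilde r_k\in\tilde S$ such that (i) $s_{i_j}\in\tilde r_j$ for $0\le j\le k$, (ii) $(\tilde r_j,\tilde r_{j+1})\in E$ for $0\le j<k$, and (iii) for $0\le j<k$, the states strictly between the times $i_j$ and $i_{j+1}$ lie in no subgoal region other than $\tilde r_j$ and $\tilde r_{j+1}$. Then the equations of R-AVI have a unique solution $\tilde V$, and every policy $\pi_{\tilde\rho}$ obtained from it satisfies $$J(\pi_{\tilde\rho})\ \ge\ J(\pi^*)-\frac{(1-\gamma)\varepsilon_R+|\tilde S|\varepsilon_T}{(1-\gamma)\bigl(1-(\gamma+|\tilde S|\varepsilon_T)\bigr)}.$$ The same bound holds with any policy $\pi$ in place of $\pi^*$, whether or not an optimal policy exists. -/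

import Mathlib

open MeasureTheory

/-- A deterministic policy (measurable, so that its expected value makes sense). -/
abbrev Policy (S A : Type*) [MeasurableSpace S] [MeasurableSpace A] :=
  {π : S → A // Measurable π}

/-- A Markov decision process `(S, A, T, R, γ, η₀)` whose transitions `T : S → A → S` are
deterministic, with rewards in `[0, 1]` and discount factor in `[0, 1)`. -/
structure DetMDP (S A : Type*) [MeasurableSpace S] [MeasurableSpace A] where
  T : S → A → S
  R : S → A → ℝ
  γ : ℝ
  η₀ : Measure S
  measurable_T : Measurable (Function.uncurry T)
  measurable_R : Measurable (Function.uncurry R)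
  R_nonneg : ∀ s a, 0 ≤ R s a
  R_le_one : ∀ s a, R s a ≤ 1
  γ_nonneg : 0 ≤ γ
  γ_lt_one : γ < 1
  prob_η₀ : IsProbabilityMeasure η₀

/-- A finite family of pairwise disjoint subgoal regions, with edges, the region `start` in which
episodes start and the region `goal`. -/
structure SubgoalRegions (S ι : Type*) [MeasurableSpace S] where
  region : ι → Set S
  measurable_region : ∀ i, MeasurableSet (region i)
  disjoint_region : ∀ i j, i ≠ j → Disjoint (region i) (region j)
  E : Set (ι × ι)
  start : ι
  goal : ι

/-- A subgoal transition: the option `(π, I, β)` with policy `π = pol`, initial set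
`I = region src`, and `β` the indicator of the set `SubgoalRegions.exits src` below. -/
structure SubgoalTransition (S A ι : Type*) [MeasurableSpace S] [MeasurableSpace A] where
  pol : Policy S A
  src : ι

section

variable {S A ι : Type*} [MeasurableSpace S] [MeasurableSpace A]

namespace SubgoalRegions

/-- The union of all subgoal regions. -/
def union (G : SubgoalRegions S ι) : Set S := ⋃ i, G.region i

/-- The termination set of a subgoal transition started in region `i`: all other regions. -/
def exits (G : SubgoalRegions S ι) (i : ι) : Set S := G.union \ G.region i

/-- The ideal subgoal transitions built from policies `p i j`: one for each edge `(i, j)` with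
`i ≠ j` and `i` not the goal. -/
def transitions (G : SubgoalRegions S ι) (p : ι → ι → Policy S A) :
    Set (SubgoalTransition S A ι) :=
  {o | ∃ i j, (i, j) ∈ G.E ∧ i ≠ j ∧ i ≠ G.goal ∧ o = ⟨p i j, i⟩}

open Classical in
/-- The region whose option is in use on arriving at state `s`, if so far the option of region `i`
was in use: it changes exactly when `s` lies in another region. -/
noncomputable def update (G : SubgoalRegions S ι) (i : ι) (s : S) : ι :=
  if h : ∃ j, j ≠ i ∧ s ∈ G.region j then h.choose else i

end SubgoalRegions

namespace DetMDP

variable (M : DetMDP S A) (G : SubgoalRegions S ι)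

/-- The state after `t` steps of the policy `π` from `s`. -/
def traj (π : Policy S A) (s : S) (t : ℕ) : S := (fun x => M.T x (π.1 x))^[t] s

/-- The value `V^π(s)`: the discounted total reward of `π` from `s`. -/
noncomputable def value (π : Policy S A) (s : S) : ℝ :=
  ∑' t, M.γ ^ t * M.R (M.traj π s t) (π.1 (M.traj π s t))

/-- `J(π)`: the expected value of `π` from the initial distribution. -/
noncomputable def J (π : Policy S A) : ℝ := ∫ s, M.value π s ∂M.η₀

/-- `π` maximizes `J` among all policies. -/
def IsOptimalPolicy (π : Policy S A) : Prop := ∀ π', M.J π' ≤ M.J π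

/-- The option `o`, started at `s`, has not terminated at any of the times `1, …, t`. -/
def Running (o : SubgoalTransition S A ι) (s : S) (t : ℕ) : Prop :=
  ∀ l, 1 ≤ l → l ≤ t → M.traj o.pol s l ∉ G.exits o.src

/-- The option `o`, started at `s`, terminates after exactly `t ≥ 1` steps, in region `j`. -/
def TerminatesIn (o : SubgoalTransition S A ι) (s : S) (t : ℕ) (j : ι) : Prop :=
  1 ≤ t ∧ M.Running G o s (t - 1) ∧
    M.traj o.pol s t ∈ G.exits o.src ∧ M.traj o.pol s t ∈ G.region j

open Classical in
/-- `T̃(s, o, j)`: the time-discounted probability that `o` started at `s` terminates in region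
`j`. Transitions being deterministic, the probability of termination in `j` after `t` steps
is `0` or `1`. -/
noncomputable def optT (o : SubgoalTransition S A ι) (s : S) (j : ι) : ℝ :=
  ∑' t, M.γ ^ t * (if M.TerminatesIn G o s t j then 1 else 0)

open Classical in
/-- `R_opt(s, o)`: the discounted reward of `o` from `s` before termination; the reward of step
`t` counts as long as `o` has not terminated at a time `≤ t`. -/
noncomputable def optR (o : SubgoalTransition S A ι) (s : S) : ℝ :=
  ∑' t, if M.Running G o s t then
    M.γ ^ t * M.R (M.traj o.pol s t) (o.pol.1 (M.traj o.pol s t)) else 0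

/-- Worst-case and best-case transitions and rewards over the states of the region in which the
option starts. (An empty region gives `0`.) -/
noncomputable def Tinf (o : SubgoalTransition S A ι) (j : ι) : ℝ :=
  sInf ((fun s => M.optT G o s j) '' G.region o.src)

noncomputable def Tsup (o : SubgoalTransition S A ι) (j : ι) : ℝ :=
  sSup ((fun s => M.optT G o s j) '' G.region o.src)

noncomputable def Rinf (o : SubgoalTransition S A ι) : ℝ :=
  sInf ((fun s => M.optR G o s) '' G.region o.src)

noncomputable def Rsup (o : SubgoalTransition S A ι) : ℝ :=
  sSup ((fun s => M.optR G o s) '' G.region o.src)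

/-- `ε_T`: the maximum over the options `o ∈ O`, each at the region where it starts, and the
regions `j`. (A maximum over the empty set is `0`, here and below.) -/
noncomputable def epsT (O : Set (SubgoalTransition S A ι)) : ℝ :=
  sSup {x | ∃ o ∈ O, ∃ j, x = M.Tsup G o j - M.Tinf G o j}

/-- `ε_R`: the maximum over the options `o ∈ O`, each at the region where it starts. -/
noncomputable def epsR (O : Set (SubgoalTransition S A ι)) : ℝ :=
  sSup {x | ∃ o ∈ O, x = M.Rsup G o - M.Rinf G o}

/-- `Q̃_inf(o)` at the region where `o` starts, for an abstract value function `V`. -/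
noncomputable def Qinf [Fintype ι] (V : ι → ℝ) (o : SubgoalTransition S A ι) : ℝ :=
  M.Rinf G o + ∑ j, M.Tinf G o j * V j

/-- `V` solves the recursive equations of robust abstract value iteration for the lower bounds:
`V i` is the maximum of `Q̃_inf` over the options of `O` that start in region `i`, and `0` if there
are none (as at the goal). -/
def IsConservativeValue [Fintype ι] (O : Set (SubgoalTransition S A ι)) (V : ι → ℝ) : Prop :=
  ∀ i, V i = sSup {x | ∃ o ∈ O, o.src = i ∧ x = M.Qinf G V o}

/-- `ρ` is a conservative optimal option policy: on region `i` it uses an option of `O` that starts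
there and maximizes `Q̃_inf`. Where no option of `O` starts (as at the goal), `ρ i` is arbitrary. -/
def IsConservativeOptimal [Fintype ι] (O : Set (SubgoalTransition S A ι)) (V : ι → ℝ)
    (ρ : ι → SubgoalTransition S A ι) : Prop :=
  ∀ i, (ρ i).src = i ∧ ((∃ o ∈ O, o.src = i) →
    ρ i ∈ O ∧ ∀ o ∈ O, o.src = i → M.Qinf G V o ≤ M.Qinf G V (ρ i))

/-- One step of the policy induced by the option policy `ρ`. Its internal state is the region
whose option is in use; the option is replaced on arrival in another region. -/
noncomputable def optionStep (ρ : ι → SubgoalTransition S A ι) (c : S × ι) : S × ι :=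
  (M.T c.1 ((ρ c.2).pol.1 c.1), G.update c.2 (M.T c.1 ((ρ c.2).pol.1 c.1)))

/-- The discounted total reward of the policy induced by `ρ`, from state `s` with the option of
region `i` in use. -/
noncomputable def optionValue (ρ : ι → SubgoalTransition S A ι) (s : S) (i : ι) : ℝ :=
  ∑' t, M.γ ^ t * M.R ((M.optionStep G ρ)^[t] (s, i)).1
    ((ρ ((M.optionStep G ρ)^[t] (s, i)).2).pol.1 ((M.optionStep G ρ)^[t] (s, i)).1)

/-- `J(π_ρ)` for the policy `π_ρ` induced by `ρ`; episodes start in the region `G.start`. -/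
noncomputable def optionJ (ρ : ι → SubgoalTransition S A ι) : ℝ :=
  ∫ s, M.optionValue G ρ s G.start ∂M.η₀

/-- The policies `p i j` define ideal subgoal transitions: for each edge `(i, j)` used, `p i j`
maximizes the best-case time-discounted probability of moving from region `i` to region `j`. -/
def IsIdeal (p : ι → ι → Policy S A) : Prop :=
  ∀ i j, (i, j) ∈ G.E → i ≠ j → i ≠ G.goal →
    ∀ π : Policy S A, M.Tsup G ⟨π, i⟩ j ≤ M.Tsup G ⟨p i j, i⟩ j

/-- The goal region is a sink, and the reward is `1` on entering it and `0` otherwise. -/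
def IsSparseReachability : Prop :=
  (∀ s ∈ G.region G.goal, ∀ a, M.T s a = s) ∧
  (∀ s a, s ∉ G.region G.goal ∧ M.T s a ∈ G.region G.goal → M.R s a = 1) ∧
  (∀ s a, ¬ (s ∉ G.region G.goal ∧ M.T s a ∈ G.region G.goal) → M.R s a = 0)

/-- Bottleneck assumption: every trajectory `s 0, a 0, s 1, …, s t` from the start region to the
goal region is a sequence of transitions between regions `r 0, …, r k` along edges, where between
the times `idx j` and `idx (j + 1)` it meets no region except `r j` and `r (j + 1)`. -/
def IsBottleneck : Prop :=
  ∀ (t : ℕ) (s : ℕ → S) (a : ℕ → A), (∀ l < t, s (l + 1) = M.T (s l) (a l)) →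
    s 0 ∈ G.region G.start → s t ∈ G.region G.goal →
    ∃ (k : ℕ) (idx : ℕ → ℕ) (r : ℕ → ι), idx 0 = 0 ∧ idx k = t ∧
      (∀ j < k, idx j < idx (j + 1)) ∧
      (∀ j ≤ k, s (idx j) ∈ G.region (r j)) ∧
      (∀ j < k, (r j, r (j + 1)) ∈ G.E) ∧
      (∀ j < k, ∀ l, idx j < l → l < idx (j + 1) →
        ∀ i, s l ∈ G.region i → i = r j ∨ i = r (j + 1))

end DetMDP

end

section

variable {S A ι : Type*} [MeasurableSpace S] [MeasurableSpace A]

/-! The conservative value `V` of the start region separates the two policies: it lies below the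
value of the induced policy, and any policy exceeds it by at most `B = εR + εT / (1 - γ)`. Since `B`
is at most the stated fraction, integrating over `η₀` finishes the proof.

Existence and uniqueness of `V` come from Banach's theorem: an option lasts at least one step, so `∑
j, Tinf o j ≤ γ` and the Bellman operator is a `γ`-contraction.

Lower half (`IsConservativeValue.le_optionValue`): `V ≥ 0`, so worst-case data underestimate the
true return of every option; unrolling `n` options leaves an error of order `γ ^ n`.

Upper half (`value_le_conservativeValue_add`): a policy first reaching the goal at time `t + 1` has
value `γ ^ t`. The bottleneck assumption cuts its trajectory into moves along edges. A move of `n`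
steps gives `γ ^ n ≤ Tsup ≤ Tinf + εT` for the ideal option of its edge, and the last move compares
with `Rsup ≤ Rinf + εR` instead. Backward induction over the moves, using `V ≤ 1`, accumulates the
error: each move costs `εT` and discounts the later error by at least `γ`, whence the geometric sum
in `B`. -/

/-- Suprema of two functions over a finite set differ by no more than the functions do. -/
theorem abs_sSup_image_sub_sSup_image_le {α : Type*} {s : Set α} (hs : s.Finite) {f g : α → ℝ}
    {c : ℝ} (hc : 0 ≤ c) (h : ∀ a ∈ s, |f a - g a| ≤ c) :
    |sSup (f '' s) - sSup (g '' s)| ≤ c := by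
  rcases s.eq_empty_or_nonempty with rfl | hne
  · simpa using hc
  have key : ∀ f g : α → ℝ, (∀ a ∈ s, |f a - g a| ≤ c) → sSup (f '' s) ≤ sSup (g '' s) + c := by
    intro f g h
    refine csSup_le (hne.image f) ?_
    rintro _ ⟨a, ha, rfl⟩
    have h1 := le_csSup (hs.image g).bddAbove (Set.mem_image_of_mem g ha)
    have h2 := (abs_le.1 (h a ha)).2
    linarith
  have h1 := key f g h
  have h2 := key g f fun a ha => by rw [abs_sub_comm]; exact h a ha
  rw [abs_le]
  constructor <;> linarith

/-! ### Disjoint regions and the rule for switching options -/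

namespace SubgoalRegions

variable (G : SubgoalRegions S ι)

theorem eq_of_mem_region {i j : ι} {s : S} (hi : s ∈ G.region i) (hj : s ∈ G.region j) :
    i = j := by
  by_contra h
  exact Set.disjoint_left.1 (G.disjoint_region i j h) hi hj

theorem mem_exits_iff {i : ι} {s : S} : s ∈ G.exits i ↔ ∃ j, j ≠ i ∧ s ∈ G.region j := by
  simp only [exits, union, Set.mem_sdiff, Set.mem_iUnion]
  constructor
  · rintro ⟨⟨j, hj⟩, hi⟩
    exact ⟨j, fun h => hi (h ▸ hj), hj⟩
  · rintro ⟨j, hji, hj⟩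
    exact ⟨⟨j, hj⟩, fun hi => hji (G.eq_of_mem_region hj hi)⟩

theorem update_of_notMem_exits {i : ι} {s : S} (h : s ∉ G.exits i) : G.update i s = i := by
  rw [mem_exits_iff] at h
  rw [update, dif_neg h]

theorem update_of_mem_region {i j : ι} {s : S} (hji : j ≠ i) (hj : s ∈ G.region j) :
    G.update i s = j := by
  have h : ∃ j, j ≠ i ∧ s ∈ G.region j := ⟨j, hji, hj⟩
  rw [update, dif_pos h]
  exact G.eq_of_mem_region h.choose_spec.2 hj

theorem measurableSet_exits [Countable ι] (i : ι) : MeasurableSet (G.exits i) :=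
  (MeasurableSet.iUnion G.measurable_region).diff (G.measurable_region i)

theorem measurable_update [Countable ι] [MeasurableSpace ι] (i : ι) :
    Measurable (G.update i) := by
  refine measurable_to_countable' fun j => ?_
  -- The fibre over the current index is the complement of its exits; over any other index it is
  -- that region.
  by_cases hji : j = i
  · subst hji
    convert (G.measurableSet_exits j).compl using 1
    ext s
    simp only [Set.mem_preimage, Set.mem_singleton_iff, Set.mem_compl_iff]
    refine ⟨fun h hs => ?_, G.update_of_notMem_exits⟩
    obtain ⟨k, hk, hks⟩ := G.mem_exits_iff.1 hs
    exact hk ((G.update_of_mem_region hk hks).symm.trans h)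
  · convert G.measurable_region j using 1
    ext s
    simp only [Set.mem_preimage, Set.mem_singleton_iff]
    refine ⟨fun h => ?_, G.update_of_mem_region hji⟩
    by_cases hs : s ∈ G.exits i
    · obtain ⟨k, hk, hks⟩ := G.mem_exits_iff.1 hs
      rw [G.update_of_mem_region hk hks] at h
      exact h ▸ hks
    · exact absurd ((G.update_of_notMem_exits hs).symm.trans h).symm hji

theorem finite_transitions [Finite ι] (p : ι → ι → Policy S A) : (G.transitions p).Finite := by
  refine (Set.finite_range fun x : ι × ι => (⟨p x.1 x.2, x.1⟩ : SubgoalTransition S A ι)).subset ?_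
  rintro o ⟨i, j, -, -, -, rfl⟩
  exact ⟨(i, j), rfl⟩

theorem src_ne_goal_of_mem_transitions {p : ι → ι → Policy S A} {o : SubgoalTransition S A ι}
    (ho : o ∈ G.transitions p) : o.src ≠ G.goal := by
  obtain ⟨i, j, -, -, hi, rfl⟩ := ho
  exact hi

end SubgoalRegions

namespace DetMDP

variable (M : DetMDP S A) (G : SubgoalRegions S ι)

/-! ### Trajectories and options -/

theorem traj_succ (π : Policy S A) (s : S) (t : ℕ) :
    M.traj π s (t + 1) = M.T (M.traj π s t) (π.1 (M.traj π s t)) :=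
  Function.iterate_succ_apply' _ _ _

theorem traj_add (π : Policy S A) (s : S) (m n : ℕ) :
    M.traj π s (m + n) = M.traj π (M.traj π s m) n := by
  rw [add_comm]
  exact Function.iterate_add_apply _ _ _ _

theorem summable_discounted {f : ℕ → ℝ} (h0 : ∀ t, 0 ≤ f t) (h1 : ∀ t, f t ≤ M.γ ^ t) :
    Summable f :=
  Summable.of_nonneg_of_le h0 h1 (summable_geometric_of_lt_one M.γ_nonneg M.γ_lt_one)

theorem tsum_discounted_le {f : ℕ → ℝ} (h0 : ∀ t, 0 ≤ f t) (h1 : ∀ t, f t ≤ M.γ ^ t) :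
    ∑' t, f t ≤ (1 - M.γ)⁻¹ := by
  rw [← tsum_geometric_of_lt_one M.γ_nonneg M.γ_lt_one]
  exact (M.summable_discounted h0 h1).tsum_le_tsum h1
    (summable_geometric_of_lt_one M.γ_nonneg M.γ_lt_one)

theorem discounted_reward_nonneg (t : ℕ) (s : S) (a : A) : 0 ≤ M.γ ^ t * M.R s a :=
  mul_nonneg (pow_nonneg M.γ_nonneg _) (M.R_nonneg s a)

theorem discounted_reward_le (t : ℕ) (s : S) (a : A) : M.γ ^ t * M.R s a ≤ M.γ ^ t :=
  mul_le_of_le_one_right (pow_nonneg M.γ_nonneg _) (M.R_le_one s a)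

section Options

variable {M G} {o : SubgoalTransition S A ι} {s : S}

theorem Running.mono {m n : ℕ} (h : M.Running G o s n) (hmn : m ≤ n) : M.Running G o s m :=
  fun l hl hlm => h l hl (hlm.trans hmn)

theorem TerminatesIn.not_running {t l : ℕ} {j : ι} (h : M.TerminatesIn G o s t j) (hl : t ≤ l) :
    ¬ M.Running G o s l :=
  fun hr => hr t h.1 hl h.2.2.1

theorem TerminatesIn.running {t l : ℕ} {j : ι} (h : M.TerminatesIn G o s t j) (hl : l < t) :
    M.Running G o s l :=
  h.2.1.mono (by omega)

theorem TerminatesIn.time_unique {t t' : ℕ} {j j' : ι} (h : M.TerminatesIn G o s t j)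
    (h' : M.TerminatesIn G o s t' j') : t = t' := by
  rcases lt_trichotomy t t' with hlt | rfl | hlt
  · exact absurd (h'.running hlt) (h.not_running le_rfl)
  · rfl
  · exact absurd (h.running hlt) (h'.not_running le_rfl)

theorem TerminatesIn.region_unique {t t' : ℕ} {j j' : ι} (h : M.TerminatesIn G o s t j)
    (h' : M.TerminatesIn G o s t' j') : j = j' := by
  obtain rfl := h.time_unique h'
  exact G.eq_of_mem_region h.2.2.2 h'.2.2.2

theorem TerminatesIn.ne_src {t : ℕ} {j : ι} (h : M.TerminatesIn G o s t j) : j ≠ o.src := by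
  rintro rfl
  exact h.2.2.1.2 h.2.2.2

theorem TerminatesIn.optT_eq {t : ℕ} {j : ι} (h : M.TerminatesIn G o s t j) :
    M.optT G o s j = M.γ ^ t := by
  rw [optT, tsum_eq_single t, if_pos h, mul_one]
  intro t' ht'
  rw [if_neg fun h' => ht' (h'.time_unique h), mul_zero]

theorem optT_eq_zero {j : ι} (h : ∀ t, ¬ M.TerminatesIn G o s t j) : M.optT G o s j = 0 := by
  simp [optT, h]

/-- By determinism only one region carries mass, so the sum over successors collapses to one term.
-/
theorem TerminatesIn.sum_optT_mul [Fintype ι] {t : ℕ} {j : ι} (h : M.TerminatesIn G o s t j)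
    (V : ι → ℝ) : ∑ k, M.optT G o s k * V k = M.γ ^ t * V j := by
  rw [Finset.sum_eq_single j, h.optT_eq]
  · intro k _ hk
    rw [optT_eq_zero fun t' h' => hk (h'.region_unique h), zero_mul]
  · simp

theorem TerminatesIn.pow_le {t : ℕ} {j : ι} (h : M.TerminatesIn G o s t j) : M.γ ^ t ≤ M.γ := by
  simpa using pow_le_pow_of_le_one M.γ_nonneg M.γ_lt_one.le h.1

variable (M G o s)

/-- Either the option terminates, or it runs forever. -/
theorem exists_terminatesIn_or_forall_running :
    (∃ t j, M.TerminatesIn G o s t j) ∨ ∀ t, M.Running G o s t := by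
  classical
  by_cases h : ∃ t, 1 ≤ t ∧ M.traj o.pol s t ∈ G.exits o.src
  · left
    have hmem := (Nat.find_spec h).2
    obtain ⟨j, -, hj⟩ := G.mem_exits_iff.1 hmem
    refine ⟨Nat.find h, j, (Nat.find_spec h).1, fun l h1 h2 hl => ?_, hmem, hj⟩
    have := Nat.find_min' h ⟨h1, hl⟩
    have := (Nat.find_spec h).1
    omega
  · right
    push Not at h
    exact fun t l h1 _ => h l h1

theorem optT_nonneg (j : ι) : 0 ≤ M.optT G o s j := by
  refine tsum_nonneg fun t => mul_nonneg (pow_nonneg M.γ_nonneg _) ?_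
  split_ifs <;> norm_num

theorem optT_le (j : ι) : M.optT G o s j ≤ M.γ := by
  by_cases h : ∃ t, M.TerminatesIn G o s t j
  · obtain ⟨t, ht⟩ := h
    rw [ht.optT_eq]
    exact ht.pow_le
  · rw [optT_eq_zero (not_exists.1 h)]
    exact M.γ_nonneg

theorem sum_optT_le [Fintype ι] : ∑ j, M.optT G o s j ≤ M.γ := by
  by_cases h : ∃ t j, M.TerminatesIn G o s t j
  · obtain ⟨t, j, ht⟩ := h
    have := ht.sum_optT_mul fun _ => 1
    simp only [mul_one] at this
    rw [this]
    exact ht.pow_le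
  · rw [Finset.sum_eq_zero fun j _ => optT_eq_zero fun t ht => h ⟨t, j, ht⟩]
    exact M.γ_nonneg

theorem optR_nonneg : 0 ≤ M.optR G o s := by
  refine tsum_nonneg fun t => ?_
  split_ifs
  exacts [M.discounted_reward_nonneg _ _ _, le_rfl]

theorem optR_le : M.optR G o s ≤ (1 - M.γ)⁻¹ := by
  refine M.tsum_discounted_le (fun t => ?_) fun t => ?_
  · split_ifs
    exacts [M.discounted_reward_nonneg _ _ _, le_rfl]
  · split_ifs
    exacts [M.discounted_reward_le _ _ _, pow_nonneg M.γ_nonneg _]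

theorem bddBelow_optT (j : ι) : BddBelow ((fun s => M.optT G o s j) '' G.region o.src) :=
  ⟨0, by rintro _ ⟨s, -, rfl⟩; exact M.optT_nonneg G o s j⟩

theorem bddAbove_optT (j : ι) : BddAbove ((fun s => M.optT G o s j) '' G.region o.src) :=
  ⟨M.γ, by rintro _ ⟨s, -, rfl⟩; exact M.optT_le G o s j⟩

theorem bddBelow_optR : BddBelow ((fun s => M.optR G o s) '' G.region o.src) :=
  ⟨0, by rintro _ ⟨s, -, rfl⟩; exact M.optR_nonneg G o s⟩

theorem bddAbove_optR : BddAbove ((fun s => M.optR G o s) '' G.region o.src) :=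
  ⟨(1 - M.γ)⁻¹, by rintro _ ⟨s, -, rfl⟩; exact M.optR_le G o s⟩

theorem Tinf_nonneg (j : ι) : 0 ≤ M.Tinf G o j :=
  Real.sInf_nonneg (by rintro _ ⟨s, -, rfl⟩; exact M.optT_nonneg G o s j)

theorem Rinf_nonneg : 0 ≤ M.Rinf G o :=
  Real.sInf_nonneg (by rintro _ ⟨s, -, rfl⟩; exact M.optR_nonneg G o s)

variable {o s}

theorem Tinf_le (hs : s ∈ G.region o.src) (j : ι) : M.Tinf G o j ≤ M.optT G o s j :=
  csInf_le (M.bddBelow_optT G o j) ⟨s, hs, rfl⟩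

theorem le_Tsup (hs : s ∈ G.region o.src) (j : ι) : M.optT G o s j ≤ M.Tsup G o j :=
  le_csSup (M.bddAbove_optT G o j) ⟨s, hs, rfl⟩

theorem Rinf_le (hs : s ∈ G.region o.src) : M.Rinf G o ≤ M.optR G o s :=
  csInf_le (M.bddBelow_optR G o) ⟨s, hs, rfl⟩

theorem le_Rsup (hs : s ∈ G.region o.src) : M.optR G o s ≤ M.Rsup G o :=
  le_csSup (M.bddAbove_optR G o) ⟨s, hs, rfl⟩

/-- Nonnegativity of `V` is what makes smaller transition weights give a smaller sum. -/
theorem Qinf_le [Fintype ι] {V : ι → ℝ} (hV : ∀ i, 0 ≤ V i) (hs : s ∈ G.region o.src) :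
    M.Qinf G V o ≤ M.optR G o s + ∑ j, M.optT G o s j * V j :=
  add_le_add (M.Rinf_le G hs)
    (Finset.sum_le_sum fun j _ => mul_le_mul_of_nonneg_right (M.Tinf_le G hs j) (hV j))

theorem Qinf_eq_zero_of_region_eq_empty [Fintype ι] (V : ι → ℝ) (h : G.region o.src = ∅) :
    M.Qinf G V o = 0 := by
  simp [Qinf, Rinf, Tinf, h]

variable (o)

/-- All infima are bounded by the values at one common state, where the total mass is at most `γ`;
this is the contraction factor. For an empty region every infimum is `0` by default. -/
theorem sum_Tinf_le [Fintype ι] : ∑ j, M.Tinf G o j ≤ M.γ := by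
  rcases (G.region o.src).eq_empty_or_nonempty with h | ⟨s, hs⟩
  · simpa [Tinf, h] using M.γ_nonneg
  · exact (Finset.sum_le_sum fun j _ => M.Tinf_le G hs j).trans (M.sum_optT_le G o s)

theorem Tinf_le_Tsup (j : ι) : M.Tinf G o j ≤ M.Tsup G o j := by
  rcases (G.region o.src).eq_empty_or_nonempty with h | ⟨s, hs⟩
  · simp [Tinf, Tsup, h]
  · exact (M.Tinf_le G hs j).trans (M.le_Tsup G hs j)

theorem Rinf_le_Rsup : M.Rinf G o ≤ M.Rsup G o := by
  rcases (G.region o.src).eq_empty_or_nonempty with h | ⟨s, hs⟩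
  · simp [Rinf, Rsup, h]
  · exact (M.Rinf_le G hs).trans (M.le_Rsup G hs)

end Options

/-! ### The gaps between best and worst case -/

variable {O : Set (SubgoalTransition S A ι)}

theorem epsT_nonneg (O : Set (SubgoalTransition S A ι)) : 0 ≤ M.epsT G O :=
  Real.sSup_nonneg (by rintro _ ⟨o, -, j, rfl⟩; exact sub_nonneg.2 (M.Tinf_le_Tsup G o j))

theorem epsR_nonneg (O : Set (SubgoalTransition S A ι)) : 0 ≤ M.epsR G O :=
  Real.sSup_nonneg (by rintro _ ⟨o, -, rfl⟩; exact sub_nonneg.2 (M.Rinf_le_Rsup G o))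

/-- Finiteness makes the set of gaps bounded above, so that its `sSup` is a genuine supremum. -/
theorem Tsup_sub_Tinf_le_epsT [Finite ι] (hO : O.Finite) {o : SubgoalTransition S A ι}
    (ho : o ∈ O) (j : ι) : M.Tsup G o j - M.Tinf G o j ≤ M.epsT G O := by
  refine le_csSup (Set.Finite.bddAbove ?_) ⟨o, ho, j, rfl⟩
  refine ((hO.prod (Set.finite_univ (α := ι))).image
    fun x => M.Tsup G x.1 x.2 - M.Tinf G x.1 x.2).subset ?_
  rintro _ ⟨o, ho, j, rfl⟩
  exact ⟨(o, j), ⟨ho, trivial⟩, rfl⟩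

theorem Rsup_sub_Rinf_le_epsR (hO : O.Finite) {o : SubgoalTransition S A ι} (ho : o ∈ O) :
    M.Rsup G o - M.Rinf G o ≤ M.epsR G O := by
  refine le_csSup (Set.Finite.bddAbove ?_) ⟨o, ho, rfl⟩
  refine (hO.image fun o => M.Rsup G o - M.Rinf G o).subset ?_
  rintro _ ⟨o, ho, rfl⟩
  exact ⟨o, ho, rfl⟩

/-! ### Robust abstract value iteration -/

section ValueIteration

variable [Fintype ι]

/-- The operator whose fixed points are the conservative values. -/
noncomputable def bellman (O : Set (SubgoalTransition S A ι)) (V : ι → ℝ) (i : ι) : ℝ :=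
  sSup (M.Qinf G V '' {o | o ∈ O ∧ o.src = i})

theorem setOf_Qinf_eq_image (O : Set (SubgoalTransition S A ι)) (V : ι → ℝ) (i : ι) :
    {x | ∃ o ∈ O, o.src = i ∧ x = M.Qinf G V o} = M.Qinf G V '' {o | o ∈ O ∧ o.src = i} := by
  ext x
  constructor
  · rintro ⟨o, ho, hi, rfl⟩
    exact ⟨o, ⟨ho, hi⟩, rfl⟩
  · rintro ⟨o, ⟨ho, hi⟩, rfl⟩
    exact ⟨o, ho, hi, rfl⟩

theorem isConservativeValue_iff_isFixedPt {V : ι → ℝ} :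
    M.IsConservativeValue G O V ↔ Function.IsFixedPt (M.bellman G O) V := by
  simp only [IsConservativeValue, setOf_Qinf_eq_image]
  exact ⟨fun h => funext fun i => (h i).symm, fun h i => (congrFun h i).symm⟩

theorem abs_Qinf_sub_Qinf_le (V W : ι → ℝ) (o : SubgoalTransition S A ι) :
    |M.Qinf G V o - M.Qinf G W o| ≤ M.γ * dist V W := by
  have : M.Qinf G V o - M.Qinf G W o = ∑ j, M.Tinf G o j * (V j - W j) := by
    simp only [Qinf, mul_sub, Finset.sum_sub_distrib]
    ring
  rw [this]
  calc |∑ j, M.Tinf G o j * (V j - W j)|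
      ≤ ∑ j, |M.Tinf G o j * (V j - W j)| := Finset.abs_sum_le_sum_abs _ _
    _ ≤ ∑ j, M.Tinf G o j * dist V W := by
        refine Finset.sum_le_sum fun j _ => ?_
        rw [abs_mul, abs_of_nonneg (M.Tinf_nonneg G o j), ← Real.dist_eq]
        exact mul_le_mul_of_nonneg_left (dist_le_pi_dist V W j) (M.Tinf_nonneg G o j)
    _ = (∑ j, M.Tinf G o j) * dist V W := (Finset.sum_mul _ _ _).symm
    _ ≤ M.γ * dist V W := mul_le_mul_of_nonneg_right (M.sum_Tinf_le G o) dist_nonneg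

theorem contractingWith_bellman (hO : O.Finite) :
    ContractingWith ⟨M.γ, M.γ_nonneg⟩ (M.bellman G O) := by
  refine ⟨M.γ_lt_one, LipschitzWith.of_dist_le_mul fun V W => ?_⟩
  have hc : 0 ≤ M.γ * dist V W := mul_nonneg M.γ_nonneg dist_nonneg
  refine (dist_pi_le_iff hc).2 fun i => ?_
  rw [Real.dist_eq]
  exact abs_sSup_image_sub_sSup_image_le (hO.subset fun o ho => ho.1) hc
    fun o _ => M.abs_Qinf_sub_Qinf_le G V W o

theorem existsUnique_isConservativeValue (hO : O.Finite) :
    ∃! V, M.IsConservativeValue G O V := by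
  have h := M.contractingWith_bellman G hO
  simp only [isConservativeValue_iff_isFixedPt]
  exact ⟨_, h.fixedPoint_isFixedPt, fun V hV => h.fixedPoint_unique hV⟩

variable {M G} {V : ι → ℝ}

theorem IsConservativeValue.Qinf_le (hV : M.IsConservativeValue G O V) (hO : O.Finite)
    {o : SubgoalTransition S A ι} (ho : o ∈ O) : M.Qinf G V o ≤ V o.src := by
  rw [hV o.src, setOf_Qinf_eq_image]
  exact le_csSup ((hO.subset fun o ho => ho.1).image _).bddAbove ⟨o, ⟨ho, rfl⟩, rfl⟩

theorem IsConservativeValue.exists_eq_Qinf (hV : M.IsConservativeValue G O V) (hO : O.Finite)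
    {i : ι} (hi : ∃ o ∈ O, o.src = i) : ∃ o ∈ O, o.src = i ∧ V i = M.Qinf G V o := by
  obtain ⟨o, ho, hoi⟩ := hi
  have hmem : V i ∈ M.Qinf G V '' {o | o ∈ O ∧ o.src = i} := by
    have := hV i
    rw [setOf_Qinf_eq_image] at this
    rw [this]
    exact Set.Nonempty.csSup_mem ⟨_, o, ⟨ho, hoi⟩, rfl⟩
      ((hO.subset fun o ho => ho.1).image _)
  obtain ⟨o', ⟨h1, h2⟩, h3⟩ := hmem
  exact ⟨o', h1, h2, h3.symm⟩

theorem IsConservativeValue.eq_zero (hV : M.IsConservativeValue G O V) {i : ι}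
    (hi : ¬ ∃ o ∈ O, o.src = i) : V i = 0 := by
  have : {o | o ∈ O ∧ o.src = i} = ∅ :=
    Set.eq_empty_of_forall_notMem fun o ho => hi ⟨o, ho⟩
  rw [hV i, setOf_Qinf_eq_image, this, Set.image_empty, Real.sSup_empty]

/-- Minimum principle: at a minimizer `m` with `V m < 0`, the equation would give `V m ≥ γ * V m`,
which is impossible for `γ < 1`. -/
theorem IsConservativeValue.nonneg (hV : M.IsConservativeValue G O V) (hO : O.Finite) (i : ι) :
    0 ≤ V i := by
  have : Nonempty ι := ⟨i⟩
  obtain ⟨m, hm⟩ := Finite.exists_min V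
  refine le_trans ?_ (hm i)
  by_cases h : ∃ o ∈ O, o.src = m
  · obtain ⟨o, -, -, hVm⟩ := hV.exists_eq_Qinf hO h
    have h1 : (∑ j, M.Tinf G o j) * V m ≤ ∑ j, M.Tinf G o j * V j := by
      rw [Finset.sum_mul]
      exact Finset.sum_le_sum fun j _ => mul_le_mul_of_nonneg_left (hm j) (M.Tinf_nonneg G o j)
    have h2 := M.Rinf_nonneg G o
    have h3 := M.sum_Tinf_le G o
    have h4 := M.γ_lt_one
    rw [Qinf] at hVm
    nlinarith
  · exact (hV.eq_zero h).ge

end ValueIteration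

/-! ### The policy induced by an option policy -/

section Induced

variable {M G} {ρ : ι → SubgoalTransition S A ι} {s : S} {i : ι}

theorem optionStep_iterate_of_running (hi : (ρ i).src = i) {l : ℕ}
    (h : M.Running G (ρ i) s l) :
    (M.optionStep G ρ)^[l] (s, i) = (M.traj (ρ i).pol s l, i) := by
  induction l with
  | zero => rfl
  | succ l ih =>
    have hl : M.traj (ρ i).pol s (l + 1) ∉ G.exits i := by
      have := h (l + 1) (by omega) le_rfl
      rwa [hi] at this
    rw [Function.iterate_succ_apply', ih (h.mono l.le_succ), optionStep, ← traj_succ,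
      G.update_of_notMem_exits hl]

theorem TerminatesIn.optionStep_iterate (hi : (ρ i).src = i) {t : ℕ} {j : ι}
    (h : M.TerminatesIn G (ρ i) s t j) :
    (M.optionStep G ρ)^[t] (s, i) = (M.traj (ρ i).pol s t, j) := by
  obtain ⟨l, rfl⟩ : ∃ l, t = l + 1 := ⟨t - 1, by have := h.1; omega⟩
  rw [Function.iterate_succ_apply',
    optionStep_iterate_of_running hi (h.running (Nat.lt_succ_self l)), optionStep, ← traj_succ,
    G.update_of_mem_region (hi ▸ h.ne_src) h.2.2.2]

theorem optionValue_of_forall_running (hi : (ρ i).src = i)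
    (h : ∀ t, M.Running G (ρ i) s t) : M.optionValue G ρ s i = M.optR G (ρ i) s := by
  refine tsum_congr fun t => ?_
  rw [optionStep_iterate_of_running hi (h t), if_pos (h t)]

/-- Renewal equation: the series splits at the termination time, after which the induced process
restarts in the region just entered. -/
theorem TerminatesIn.optionValue_eq (hi : (ρ i).src = i) {t : ℕ} {j : ι}
    (h : M.TerminatesIn G (ρ i) s t j) :
    M.optionValue G ρ s i =
      M.optR G (ρ i) s + M.γ ^ t * M.optionValue G ρ (M.traj (ρ i).pol s t) j := by
  have hsum := M.summable_discounted
    (fun n => M.discounted_reward_nonneg n ((M.optionStep G ρ)^[n] (s, i)).1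
      ((ρ ((M.optionStep G ρ)^[n] (s, i)).2).pol.1 ((M.optionStep G ρ)^[n] (s, i)).1))
    (fun n => M.discounted_reward_le n _ _)
  rw [optionValue, ← hsum.sum_add_tsum_nat_add t]
  congr 1
  · rw [optR, tsum_eq_sum (s := Finset.range t)]
    · refine Finset.sum_congr rfl fun l hl => ?_
      have hr := h.running (Finset.mem_range.1 hl)
      rw [if_pos hr, optionStep_iterate_of_running hi hr]
    · intro l hl
      rw [if_neg (h.not_running (by simpa using hl))]
  · rw [optionValue, ← tsum_mul_left]
    refine tsum_congr fun n => ?_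
    rw [Function.iterate_add_apply, h.optionStep_iterate hi, pow_add]
    ring

variable (M G) in
theorem optionValue_nonneg (ρ : ι → SubgoalTransition S A ι) (s : S) (i : ι) :
    0 ≤ M.optionValue G ρ s i :=
  tsum_nonneg fun _ => M.discounted_reward_nonneg _ _ _

variable (M G) in
theorem optionValue_le (ρ : ι → SubgoalTransition S A ι) (s : S) (i : ι) :
    M.optionValue G ρ s i ≤ (1 - M.γ)⁻¹ :=
  M.tsum_discounted_le (fun _ => M.discounted_reward_nonneg _ _ _)
    fun _ => M.discounted_reward_le _ _ _

variable [Fintype ι] {V : ι → ℝ}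

/-- A conservative optimal option policy achieves at least the conservative value. -/
theorem IsConservativeValue.le_optionValue (hV : M.IsConservativeValue G O V) (hO : O.Finite)
    (hρ : M.IsConservativeOptimal G O V ρ) (hs : s ∈ G.region i) :
    V i ≤ M.optionValue G ρ s i := by
  have hV0 := hV.nonneg hO
  obtain ⟨C, hC0, hC⟩ : ∃ C, 0 ≤ C ∧ ∀ i, V i ≤ C :=
    ⟨∑ i, V i, Finset.sum_nonneg fun i _ => hV0 i,
      fun i => Finset.single_le_sum (fun j _ => hV0 j) (Finset.mem_univ i)⟩
  -- `n` counts options, not steps; each option lasts at least one step and so contributes a factor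
  -- of at most `γ`.
  have key : ∀ n : ℕ, ∀ i, ∀ s ∈ G.region i, V i ≤ M.optionValue G ρ s i + M.γ ^ n * C := by
    intro n
    induction n with
    | zero =>
      intro i s _
      have := M.optionValue_nonneg G ρ s i
      have := hC i
      simp only [pow_zero, one_mul]
      linarith
    | succ n ih =>
      intro i s hs
      have hpos : 0 ≤ M.γ ^ (n + 1) * C := mul_nonneg (pow_nonneg M.γ_nonneg _) hC0
      obtain ⟨hi, hopt⟩ := hρ i
      by_cases hne : ∃ o ∈ O, o.src = i
      · obtain ⟨o, ho, hoi, hVi⟩ := hV.exists_eq_Qinf hO hne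
        have hle : V i ≤ M.optR G (ρ i) s + ∑ j, M.optT G (ρ i) s j * V j :=
          hVi.le.trans (((hopt hne).2 o ho hoi).trans (M.Qinf_le G hV0 (hi.symm ▸ hs)))
        rcases M.exists_terminatesIn_or_forall_running G (ρ i) s with ⟨t, j, ht⟩ | hr
        · rw [ht.sum_optT_mul] at hle
          rw [ht.optionValue_eq hi]
          have h1 := mul_le_mul_of_nonneg_left (ih j _ ht.2.2.2) (pow_nonneg M.γ_nonneg t)
          have h2 := mul_le_mul_of_nonneg_right ht.pow_le
            (mul_nonneg (pow_nonneg M.γ_nonneg n) hC0)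
          rw [pow_succ']
          linarith
        · rw [optionValue_of_forall_running hi hr]
          rw [Finset.sum_eq_zero fun j _ => by
            rw [optT_eq_zero fun t ht => ht.not_running le_rfl (hr t), zero_mul]] at hle
          linarith
      · have := M.optionValue_nonneg G ρ s i
        rw [hV.eq_zero hne]
        linarith
  have hlim : Filter.Tendsto (fun n : ℕ => M.optionValue G ρ s i + M.γ ^ n * C) Filter.atTop
      (nhds (M.optionValue G ρ s i)) := by
    simpa using ((tendsto_pow_atTop_nhds_zero_of_lt_one M.γ_nonneg M.γ_lt_one).mul_const
      C).const_add (M.optionValue G ρ s i)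
  exact ge_of_tendsto' hlim fun n => key n i s hs

end Induced

/-! ### Measurability of the values -/

theorem measurable_T_comp {α : Type*} [MeasurableSpace α] {f : α → S} {g : α → A}
    (hf : Measurable f) (hg : Measurable g) : Measurable fun x => M.T (f x) (g x) :=
  M.measurable_T.comp (hf.prodMk hg)

theorem measurable_R_comp {α : Type*} [MeasurableSpace α] {f : α → S} {g : α → A}
    (hf : Measurable f) (hg : Measurable g) : Measurable fun x => M.R (f x) (g x) :=
  M.measurable_R.comp (hf.prodMk hg)

theorem measurable_value (π : Policy S A) : Measurable (M.value π) := by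
  refine Measurable.tsum fun t => ?_
  have ht : Measurable fun s => M.traj π s t :=
    (M.measurable_T_comp measurable_id π.2).iterate t
  exact (M.measurable_R_comp ht (π.2.comp ht)).const_mul _

theorem measurable_optionValue [Countable ι] (ρ : ι → SubgoalTransition S A ι) (i : ι) :
    Measurable fun s => M.optionValue G ρ s i := by
  -- With the discrete σ-algebra on the countable index set, measurability on `S × ι` can be checked
  -- for each index separately.
  let : MeasurableSpace ι := ⊤
  have hpol : Measurable fun c : S × ι => (ρ c.2).pol.1 c.1 :=
    measurable_from_prod_countable_left fun i => (ρ i).pol.2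
  have hT := M.measurable_T_comp measurable_fst hpol
  have hupdate : Measurable fun c : S × ι => G.update c.2 c.1 :=
    measurable_from_prod_countable_left fun i => G.measurable_update i
  have hstep : Measurable (M.optionStep G ρ) :=
    hT.prodMk (hupdate.comp (hT.prodMk measurable_snd))
  refine Measurable.tsum fun t => ?_
  have ht : Measurable fun s => (M.optionStep G ρ)^[t] (s, i) :=
    (hstep.iterate t).comp (measurable_id.prodMk measurable_const)
  exact (M.measurable_R_comp ht.fst (hpol.comp ht)).const_mul _

theorem value_nonneg (π : Policy S A) (s : S) : 0 ≤ M.value π s :=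
  tsum_nonneg fun _ => M.discounted_reward_nonneg _ _ _

theorem value_le (π : Policy S A) (s : S) : M.value π s ≤ (1 - M.γ)⁻¹ :=
  M.tsum_discounted_le (fun _ => M.discounted_reward_nonneg _ _ _)
    fun _ => M.discounted_reward_le _ _ _

/-- A bound on the loss at each state of the start region bounds the expected loss. -/
theorem J_le_optionJ_add [Countable ι] (hstart : M.η₀ (G.region G.start)ᶜ = 0) {π : Policy S A}
    {ρ : ι → SubgoalTransition S A ι} {c : ℝ}
    (h : ∀ s ∈ G.region G.start, M.value π s ≤ M.optionValue G ρ s G.start + c) :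
    M.J π ≤ M.optionJ G ρ + c := by
  have := M.prob_η₀
  have hint : ∀ {f : S → ℝ}, Measurable f → (∀ s, 0 ≤ f s) → (∀ s, f s ≤ (1 - M.γ)⁻¹) →
      Integrable f M.η₀ := fun hf h0 h1 =>
    Integrable.of_bound hf.aestronglyMeasurable (1 - M.γ)⁻¹
      (ae_of_all _ fun s => by rw [Real.norm_of_nonneg (h0 s)]; exact h1 s)
  have hρ := hint (M.measurable_optionValue G ρ G.start)
    (fun s => M.optionValue_nonneg G ρ s _) (fun s => M.optionValue_le G ρ s _)
  calc M.J π ≤ ∫ s, (M.optionValue G ρ s G.start + c) ∂M.η₀ := by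
        refine integral_mono_ae (hint (M.measurable_value π) (M.value_nonneg π) (M.value_le π))
          (hρ.add (integrable_const c)) ?_
        filter_upwards [compl_mem_ae_iff.2 hstart] with s hs
        exact h s (by simpa using hs)
    _ = M.optionJ G ρ + c := by
        rw [integral_add hρ (integrable_const c), integral_const, optionJ]
        simp

/-! ### Sparse reachability -/

section Sparse

variable {M G}

/-- Under sparse rewards an option collects its reward exactly when it terminates in the goal. -/
theorem IsSparseReachability.mul_optR_eq (hsparse : M.IsSparseReachability G)
    {o : SubgoalTransition S A ι} (ho : o.src ≠ G.goal) {s : S} (hs : s ∈ G.region o.src) :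
    M.γ * M.optR G o s = M.optT G o s G.goal := by
  have hsum : Summable fun t => M.γ ^ t * (open Classical in
      if M.TerminatesIn G o s t G.goal then (1 : ℝ) else 0) := by
    refine M.summable_discounted (fun t => mul_nonneg (pow_nonneg M.γ_nonneg _) ?_)
      fun t => mul_le_of_le_one_right (pow_nonneg M.γ_nonneg _) ?_ <;> split_ifs <;> norm_num
  -- Termination at time `0` is excluded. Dropping that term aligns termination at `t + 1` with the
  -- reward of step `t`; the shift is the factor `γ`.
  rw [optT, hsum.tsum_eq_zero_add, if_neg fun h => absurd h.1 (by norm_num), mul_zero, zero_add,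
    optR, ← tsum_mul_left]
  refine tsum_congr fun t => ?_
  by_cases hr : M.Running G o s t
  · have hgoal : M.traj o.pol s t ∉ G.region G.goal := by
      intro hg
      rcases Nat.eq_zero_or_pos t with rfl | ht
      · exact ho (G.eq_of_mem_region hs hg)
      · exact hr t ht le_rfl (G.mem_exits_iff.2 ⟨_, ho.symm, hg⟩)
    rw [if_pos hr]
    by_cases hg : M.traj o.pol s (t + 1) ∈ G.region G.goal
    · rw [if_pos ⟨by omega, hr, G.mem_exits_iff.2 ⟨_, ho.symm, hg⟩, hg⟩,
        hsparse.2.1 _ _ ⟨hgoal, by rwa [← traj_succ]⟩, pow_succ]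
      ring
    · rw [if_neg fun h => hg h.2.2.2, hsparse.2.2 _ _ fun h => hg (by rw [traj_succ]; exact h.2)]
      simp
  · rw [if_neg hr, if_neg fun h => hr (h.running t.lt_succ_self)]
    simp

theorem IsSparseReachability.Tsup_goal_le_mul_Rsup (hsparse : M.IsSparseReachability G)
    {o : SubgoalTransition S A ι} (ho : o.src ≠ G.goal) :
    M.Tsup G o G.goal ≤ M.γ * M.Rsup G o := by
  rcases (G.region o.src).eq_empty_or_nonempty with h | hne
  · simp [Tsup, Rsup, h]
  · refine csSup_le (hne.image _) ?_
    rintro _ ⟨s, hs, rfl⟩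
    show M.optT G o s G.goal ≤ _
    rw [← hsparse.mul_optR_eq ho hs]
    exact mul_le_mul_of_nonneg_left (M.le_Rsup G hs) M.γ_nonneg

/-- Under sparse rewards the conservative values are at most `1`. -/
theorem IsSparseReachability.conservativeValue_le_one [Fintype ι]
    (hsparse : M.IsSparseReachability G) (hγ : 0 < M.γ) (hO : O.Finite)
    (hgoal : ∀ o ∈ O, o.src ≠ G.goal) {V : ι → ℝ} (hV : M.IsConservativeValue G O V) (i : ι) :
    V i ≤ 1 := by
  have : Nonempty ι := ⟨i⟩
  -- Maximum principle: at a maximizer, either the option ends in the goal, where `V = 0` and the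
  -- reward is at most `1`, or it earns nothing and `V m ≤ γ * V m`.
  obtain ⟨m, hm⟩ := Finite.exists_max V
  refine (hm i).trans ?_
  by_cases hne : ∃ o ∈ O, o.src = m
  · obtain ⟨o, ho, rfl, hVm⟩ := hV.exists_eq_Qinf hO hne
    rcases (G.region o.src).eq_empty_or_nonempty with h | ⟨s, hs⟩
    · rw [hVm, M.Qinf_eq_zero_of_region_eq_empty G V h]
      exact zero_le_one
    have hle := M.Qinf_le G (hV.nonneg hO) hs
    rw [← hVm] at hle
    have hR := hsparse.mul_optR_eq (hgoal o ho) hs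
    have hV0 := hV.nonneg hO o.src
    by_cases hg : ∃ t, M.TerminatesIn G o s t G.goal
    · obtain ⟨t, ht⟩ := hg
      rw [ht.sum_optT_mul, hV.eq_zero fun ⟨o, ho, h⟩ => hgoal o ho h] at hle
      have := M.optT_le G o s G.goal
      have : M.optR G o s ≤ 1 := by
        by_contra! hlt
        nlinarith
      linarith
    · rw [optT_eq_zero (not_exists.1 hg), mul_eq_zero, or_iff_right hγ.ne'] at hR
      have h1 : ∑ j, M.optT G o s j * V j ≤ (∑ j, M.optT G o s j) * V o.src := by
        rw [Finset.sum_mul]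
        exact Finset.sum_le_sum fun j _ =>
          mul_le_mul_of_nonneg_left (hm j) (M.optT_nonneg G o s j)
      have h2 := mul_le_mul_of_nonneg_right (M.sum_optT_le G o s) hV0
      have := M.γ_lt_one
      nlinarith
  · rw [hV.eq_zero hne]
    exact zero_le_one

/-! ### Values of policies through the time of reaching the goal -/

theorem IsSparseReachability.traj_mem_goal (hsparse : M.IsSparseReachability G) (π : Policy S A)
    {s : S} {m n : ℕ} (hmn : m ≤ n) (h : M.traj π s m ∈ G.region G.goal) :
    M.traj π s n ∈ G.region G.goal := by
  induction n, hmn using Nat.le_induction with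
  | base => exact h
  | succ n _ ih => rwa [traj_succ, hsparse.1 _ ih]

/-- Under sparse rewards the value of a policy that takes `t + 1` steps to the goal is `γ ^ t`. -/
theorem IsSparseReachability.value_eq_pow (hsparse : M.IsSparseReachability G) {π : Policy S A}
    {s : S} {t : ℕ} (ht : M.traj π s (t + 1) ∈ G.region G.goal)
    (hlt : ∀ l ≤ t, M.traj π s l ∉ G.region G.goal) : M.value π s = M.γ ^ t := by
  rw [value, tsum_eq_single t, hsparse.2.1 _ _ ⟨hlt t le_rfl, by rwa [← traj_succ]⟩, mul_one]
  intro l hl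
  rw [hsparse.2.2, mul_zero]
  rintro ⟨h1, h2⟩
  rw [← traj_succ] at h2
  rcases lt_or_gt_of_ne hl with hl | hl
  · exact hlt (l + 1) hl h2
  · exact h1 (hsparse.traj_mem_goal π hl ht)

/-- Excluding only the act of entering the goal covers both trajectories that never reach it and
those that start in it. -/
theorem IsSparseReachability.value_eq_zero (hsparse : M.IsSparseReachability G) {π : Policy S A}
    {s : S} (h : ∀ l, M.traj π s l ∉ G.region G.goal ∧ M.traj π s (l + 1) ∈ G.region G.goal →
      False) : M.value π s = 0 := by
  rw [value, ← tsum_zero (α := ℝ) (β := ℕ)]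
  refine tsum_congr fun l => ?_
  rw [hsparse.2.2 _ _ fun hl => h l (by rwa [traj_succ]), mul_zero]

/-- A trajectory that moves from region `i` to region `j` in `n` steps, without meeting a third
region, bounds the best-case transition from `i` to `j` from below. -/
theorem pow_le_Tsup {π : Policy S A} {i j : ι} (hij : i ≠ j) {s : S} {n : ℕ}
    (hs : s ∈ G.region i) (hn : M.traj π s n ∈ G.region j)
    (hbetween : ∀ l, 0 < l → l < n → ∀ k, M.traj π s l ∈ G.region k → k = i ∨ k = j) :
    M.γ ^ n ≤ M.Tsup G ⟨π, i⟩ j := by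
  have hn0 : 0 < n := by
    rcases Nat.eq_zero_or_pos n with rfl | h
    · exact absurd (G.eq_of_mem_region hs hn) hij
    · exact h
  have hexit : M.traj π s n ∈ G.exits i := G.mem_exits_iff.2 ⟨j, hij.symm, hn⟩
  refine le_trans ?_ (M.le_Tsup G (o := ⟨π, i⟩) hs j)
  rcases M.exists_terminatesIn_or_forall_running G ⟨π, i⟩ s with ⟨t, k, ht⟩ | hr
  -- The trajectory may return to `i` or meet `j` before time `n`; the option can then only end
  -- earlier, which increases the discount factor.
  · have htn : t ≤ n := by
      by_contra! hlt
      exact ht.running hlt n hn0 le_rfl hexit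
    have hk : k = j := by
      rcases htn.eq_or_lt with rfl | hlt
      · exact G.eq_of_mem_region ht.2.2.2 hn
      · exact (hbetween t ht.1 hlt k ht.2.2.2).resolve_left ht.ne_src
    subst hk
    rw [ht.optT_eq]
    exact pow_le_pow_of_le_one M.γ_nonneg M.γ_lt_one.le htn
  · exact absurd hexit (hr n n hn0 le_rfl)

/-! ### Comparison of an arbitrary policy with the conservative value -/

variable [Fintype ι] {p : ι → ι → Policy S A} {V : ι → ℝ}

/-- Under the bottleneck assumption, the conservative value of the start region is at least the
value of any policy, up to the gaps between best and worst case. -/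
theorem value_le_conservativeValue_add (hγ : 0 < M.γ) (hsparse : M.IsSparseReachability G)
    (hbottleneck : M.IsBottleneck G) (hp : M.IsIdeal G p)
    (hV : M.IsConservativeValue G (G.transitions p) V) (π : Policy S A) {s : S}
    (hs : s ∈ G.region G.start) :
    M.value π s ≤ V G.start +
      (M.epsR G (G.transitions p) + M.epsT G (G.transitions p) / (1 - M.γ)) := by
  classical
  have hO := G.finite_transitions p
  have hV0 := hV.nonneg hO
  have hV1 := hsparse.conservativeValue_le_one hγ hO
    (fun o ho => G.src_ne_goal_of_mem_transitions ho) hV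
  have hR0 := M.epsR_nonneg G (G.transitions p)
  have hT0 := M.epsT_nonneg G (G.transitions p)
  have hγ1 : 0 < 1 - M.γ := sub_pos.2 M.γ_lt_one
  set εR := M.epsR G (G.transitions p)
  set εT := M.epsT G (G.transitions p)
  -- `B` is chosen to dominate the error `εR` of the last move and to be preserved by the recursion
  -- `x ↦ γ * x + εT` of the earlier ones.
  set B := εR + εT / (1 - M.γ) with hB
  have hB0 : 0 ≤ B := by positivity
  have hBR : εR ≤ B := le_add_of_nonneg_right (by positivity)
  have hBT : M.γ * B + εT ≤ B := by
    have : (1 - M.γ) * B = (1 - M.γ) * εR + εT := by rw [hB]; field_simp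
    nlinarith
  by_cases hex : ∃ t, M.traj π s t ∈ G.region G.goal
  swap
  · rw [hsparse.value_eq_zero fun l hl => hex ⟨_, hl.2⟩]
    exact add_nonneg (hV0 _) hB0
  have hspec := Nat.find_spec hex
  have hmin : ∀ l < Nat.find hex, M.traj π s l ∉ G.region G.goal := fun l hl => Nat.find_min hex hl
  rcases hτ : Nat.find hex with _ | t
  · rw [hτ] at hspec
    rw [hsparse.value_eq_zero fun l hl => hl.1 (hsparse.traj_mem_goal π l.zero_le hspec)]
    exact add_nonneg (hV0 _) hB0
  rw [hτ] at hspec hmin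
  rw [hsparse.value_eq_pow hspec fun l hl => hmin l (Nat.lt_succ_of_le hl)]
  obtain ⟨k, idx, r, h0, hk, hlt, hmem, hE, hbetween⟩ :=
    hbottleneck (t + 1) (M.traj π s) (fun l => π.1 (M.traj π s l))
      (fun l _ => M.traj_succ π s l) hs hspec
  have hrk : r k = G.goal := G.eq_of_mem_region (hmem k le_rfl) (by rwa [hk])
  -- Each remaining move takes at least one step, so every `idx j` with `j < k` precedes the goal
  -- time.
  have hidx : ∀ n, ∀ j, j + n = k → idx j + n ≤ t + 1 := by
    intro n
    induction n with
    | zero => rintro j rfl; exact hk.le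
    | succ n ih =>
      intro j hj
      have h1 := ih (j + 1) (by omega)
      have h2 := hlt j (by omega)
      omega
  -- Backward induction: `n + 1` moves remain from `r j`, and the left side is the value of `π` from
  -- time `idx j` on.
  have key : ∀ n, ∀ j, j + (n + 1) = k → M.γ ^ (t - idx j) ≤ V (r j) + B := by
    intro n
    have hstep : ∀ j < k, idx j < t + 1 ∧ r j ≠ G.goal ∧ (r j ≠ r (j + 1) →
        (⟨p (r j) (r (j + 1)), r j⟩ : SubgoalTransition S A ι) ∈ G.transitions p ∧
        M.γ ^ (idx (j + 1) - idx j) ≤ M.Tsup G ⟨p (r j) (r (j + 1)), r j⟩ (r (j + 1))) := by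
      intro j hj
      have h1 := hidx (k - j) j (by omega)
      have hjt : idx j < t + 1 := by omega
      have hg : r j ≠ G.goal := fun h => hmin _ hjt (h ▸ hmem j hj.le)
      refine ⟨hjt, hg, fun hne => ⟨⟨r j, r (j + 1), hE j hj, hne, hg, rfl⟩, ?_⟩⟩
      refine le_trans ?_ (hp _ _ (hE j hj) hne hg π)
      have hl := hlt j hj
      refine pow_le_Tsup hne (hmem j hj.le) ?_ fun l hl0 hln i hi => ?_
      · rw [← traj_add, Nat.add_sub_cancel' hl.le]
        exact hmem (j + 1) hj
      · rw [← traj_add] at hi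
        exact hbetween j hj (idx j + l) (by omega) (by omega) i hi
    induction n with
    | zero =>
      rintro j rfl
      obtain ⟨hjt, hg, hne⟩ := hstep j j.lt_succ_self
      obtain ⟨ho, hT⟩ := hne (by rwa [hrk])
      rw [hrk] at hT ho
      have h1 := hT.trans (hsparse.Tsup_goal_le_mul_Rsup hg)
      -- The last move takes `t + 1 - idx j` steps; cancelling one `γ` turns the transition bound
      -- into a reward bound.
      rw [hk, Nat.succ_sub (by omega), pow_succ'] at h1
      have h2 := le_of_mul_le_mul_left h1 hγ
      have h3 := M.Rsup_sub_Rinf_le_epsR G hO ho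
      have h4 := hV.Qinf_le hO ho
      have h5 : 0 ≤ ∑ i, M.Tinf G ⟨p (r j) G.goal, r j⟩ i * V i :=
        Finset.sum_nonneg fun i _ => mul_nonneg (M.Tinf_nonneg G _ i) (hV0 i)
      simp only [Qinf] at h4
      linarith
    | succ n ih =>
      intro j hj
      have hnext := ih (j + 1) (by omega)
      obtain ⟨hjt, -, hne⟩ := hstep j (by omega)
      have hjt' := (hstep (j + 1) (by omega)).1
      have hl := hlt j (by omega)
      have hpow : t - idx j = (idx (j + 1) - idx j) + (t - idx (j + 1)) := by omega
      -- A self-loop has no option, but none is needed: skipping it only shrinks the exponent.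
      by_cases hr : r j = r (j + 1)
      · rw [hr]
        exact (pow_le_pow_of_le_one M.γ_nonneg M.γ_lt_one.le (by omega)).trans hnext
      obtain ⟨ho, hT⟩ := hne hr
      have h1 := M.Tsup_sub_Tinf_le_epsT G hO ho (r (j + 1))
      have h2 := hV.Qinf_le hO ho
      have h3 := Finset.single_le_sum
        (f := fun i => M.Tinf G ⟨p (r j) (r (j + 1)), r j⟩ i * V i)
        (fun i _ => mul_nonneg (M.Tinf_nonneg G _ i) (hV0 i)) (Finset.mem_univ (r (j + 1)))
      have h4 := M.Rinf_nonneg G ⟨p (r j) (r (j + 1)), r j⟩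
      simp only [Qinf] at h2
      have h5 : (M.γ ^ (idx (j + 1) - idx j) - εT) * V (r (j + 1)) ≤ V (r j) := by
        refine le_trans (mul_le_mul_of_nonneg_right ?_ (hV0 _)) ((h3.trans ?_).trans h2) <;>
          linarith
      have h6 : εT * V (r (j + 1)) ≤ εT := mul_le_of_le_one_right hT0 (hV1 _)
      have h7 : M.γ ^ (idx (j + 1) - idx j) * B ≤ M.γ * B :=
        mul_le_mul_of_nonneg_right (by
          simpa using pow_le_pow_of_le_one M.γ_nonneg M.γ_lt_one.le
            (show 1 ≤ idx (j + 1) - idx j by omega)) hB0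
      have h8 := mul_le_mul_of_nonneg_left hnext (pow_nonneg M.γ_nonneg (idx (j + 1) - idx j))
      rw [hpow, pow_add]
      linarith
  have hk0 : k ≠ 0 := by
    rintro rfl
    omega
  have hr0 : r 0 = G.start := G.eq_of_mem_region (hmem 0 k.zero_le) (by rw [h0]; exact hs)
  have := key (k - 1) 0 (by omega)
  rwa [h0, hr0] at this

end Sparse

end DetMDP

end

theorem theorem2 {S A ι : Type*} [MeasurableSpace S] [MeasurableSpace A] [Fintype ι]
    (M : DetMDP S A) (G : SubgoalRegions S ι)
    (hγ : 0 < M.γ)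
    (hstart : M.η₀ (G.region G.start)ᶜ = 0)
    (hsparse : M.IsSparseReachability G)
    (hbottleneck : M.IsBottleneck G)
    (p : ι → ι → Policy S A) (hp : M.IsIdeal G p)
    (hε : (Fintype.card ι : ℝ) * M.epsT G (G.transitions p) < 1 - M.γ) :
    (∃! V : ι → ℝ, M.IsConservativeValue G (G.transitions p) V) ∧
    ∀ V : ι → ℝ, M.IsConservativeValue G (G.transitions p) V →
    ∀ ρ : ι → SubgoalTransition S A ι, M.IsConservativeOptimal G (G.transitions p) V ρ →
      (∀ πstar : Policy S A, M.IsOptimalPolicy πstar →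
        M.optionJ G ρ ≥ M.J πstar -
          ((1 - M.γ) * M.epsR G (G.transitions p)
              + (Fintype.card ι : ℝ) * M.epsT G (G.transitions p)) /
            ((1 - M.γ) * (1 - (M.γ + (Fintype.card ι : ℝ) * M.epsT G (G.transitions p))))) ∧
      (∀ π : Policy S A,
        M.optionJ G ρ ≥ M.J π -
          ((1 - M.γ) * M.epsR G (G.transitions p)
              + (Fintype.card ι : ℝ) * M.epsT G (G.transitions p)) /
            ((1 - M.γ) * (1 - (M.γ + (Fintype.card ι : ℝ) * M.epsT G (G.transitions p))))) := by
  have hO := G.finite_transitions p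
  refine ⟨M.existsUnique_isConservativeValue G hO, fun V hV ρ hρ => ?_⟩
  have hT0 := M.epsT_nonneg G (G.transitions p)
  have hR0 := M.epsR_nonneg G (G.transitions p)
  have hcard : (1 : ℝ) ≤ Fintype.card ι := by
    exact_mod_cast Fintype.card_pos_iff.2 ⟨G.start⟩
  have hγ1 : 0 < 1 - M.γ := sub_pos.2 M.γ_lt_one
  set εR := M.epsR G (G.transitions p)
  set εT := M.epsT G (G.transitions p)
  set N : ℝ := (Fintype.card ι : ℝ)
  -- The bound already proved is at least as strong: `N ≥ 1` enlarges the numerator, and the extra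
  -- denominator factor is at most `1` and, by `hε`, positive.
  have hbound : εR + εT / (1 - M.γ) ≤
      ((1 - M.γ) * εR + N * εT) / ((1 - M.γ) * (1 - (M.γ + N * εT))) := by
    have hN : εT ≤ N * εT := le_mul_of_one_le_left hT0 hcard
    have hnum : 0 ≤ (1 - M.γ) * εR + N * εT := by positivity
    calc εR + εT / (1 - M.γ) = ((1 - M.γ) * εR + εT) / (1 - M.γ) := by field_simp
      _ ≤ ((1 - M.γ) * εR + N * εT) / (1 - M.γ) := by gcongr
      _ ≤ _ := div_le_div_of_nonneg_left hnum (mul_pos hγ1 (by linarith))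
          (mul_le_of_le_one_right hγ1.le (by linarith))
  suffices h : ∀ π : Policy S A, M.optionJ G ρ ≥ M.J π -
      ((1 - M.γ) * εR + N * εT) / ((1 - M.γ) * (1 - (M.γ + N * εT))) from
    ⟨fun π _ => h π, h⟩
  intro π
  rw [ge_iff_le, sub_le_iff_le_add]
  refine M.J_le_optionJ_add G hstart fun s hs => ?_
  have h1 := DetMDP.value_le_conservativeValue_add hγ hsparse hbottleneck hp hV π hs
  have h2 := hV.le_optionValue hO hρ hs
  linarith
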